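/- Plane trees are finite rooted trees in which the children of every vertex are linearly ordered, considered up to isomorphism preserving the root, the parent–child relation and these orders. Fix an integer $D\ge 1$, real numbers $E_0,\dots,E_D$ and $\beta\in\mathbb{R}$. Let $\mathbb{T}_N$ be the (finite) set of plane trees on $N$ vertices all of whose vertices have at most $D$ children. For $T\in\mathbb{T}_N$ put $$E(T)=\sum_{v\in V(T)}E_{\deg(v)}=\sum_{i=0}^{D}\chi_i(T)\,E_i ,$$ where $\deg(v)$ is the number of children of the vertex $v$ and $\chi_i(T)$ is the number of vertices of $T$ with exactly $i$ children. For $N\ge 1$ let $\mu_N$ be the Gibbs probability measure on $\mathbb{T}_N$ given by $$\mu_N\{T\}=\frac{e^{-\beta E(T)}}{Z_N},\qquad Z_N=\sum_{T\in\mathbb{T}_N}e^{-\beta E(T)} .$$ For an integer $n\ge 0$ let $S_n$ be the set of plane trees of height exactly $n$ all of whose vertices have at most $D$ children, and for a plane tree $T$ let $\pi_{n,N}T$ be the neighbourhood of the root of radius $n$, i.e. the subtree of $T$ spanned by all vertices at distance at most $n$ from the root. Then, for every $n$, the map $\pi_{n,N}$ sends $\mathbb{T}_N$ into $S_n$ for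 all sufficiently large $N$, and there is a probability measure $P_n$ on $S_n$ such that the push-forward measures $\mu_N\pi_{n,N}^{-1}$ on $S_n$ converge to $P_n$ in total variation as $N\to\infty$. -/

import Mathlib

open MeasureTheory Filter Topology

/-- Finite plane (rooted, ordered) trees: a tree is the ordered list of the subtrees at the
children of its root. -/
inductive PlaneTree : Type
  | node : List PlaneTree → PlaneTree

namespace PlaneTree

/-- The multiset of the out-degrees (branching numbers) of all vertices of a plane tree; it has
exactly one entry per vertex. -/
def degrees : PlaneTree → Multiset ℕ
  | node cs => cs.length ::ₘ (cs.map (fun c => degrees c)).sum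

/-- The number of vertices of a plane tree. -/
def order (T : PlaneTree) : ℕ := T.degrees.card

/-- The number `χ_i(T)` of vertices of out-degree `i`. -/
def chi (i : ℕ) (T : PlaneTree) : ℕ := T.degrees.count i

/-- Every vertex has at most `D` children. -/
def Bounded (D : ℕ) (T : PlaneTree) : Prop := ∀ d ∈ T.degrees, d ≤ D

/-- The height of a plane tree: the maximal distance from a vertex to the root. -/
def height : PlaneTree → ℕ
  | node cs => (cs.map (fun c => height c + 1)).foldr max 0

/-- The neighbourhood of the root of radius `n`: the subtree spanned by all vertices whose
distance to the root is at most `n`. -/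
def nbhd : ℕ → PlaneTree → PlaneTree
  | 0, _ => node []
  | n + 1, node cs => node (cs.map (nbhd n))

/-- The space of plane trees is countable and carries the discrete `σ`-algebra. -/
instance : MeasurableSpace PlaneTree := ⊤

end PlaneTree

/-- `𝕋_N(D)`: plane trees on `N` vertices with all out-degrees at most `D`. -/
abbrev TreesOfOrder (D N : ℕ) : Type := {T : PlaneTree // T.order = N ∧ T.Bounded D}

/-- `S_n`: plane trees of height (exactly) `n` with all out-degrees at most `D`. -/
abbrev TreesOfHeight (D n : ℕ) : Type := {T : PlaneTree // T.height = n ∧ T.Bounded D}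

theorem PlaneTree.order_node (cs : List PlaneTree) :
    (PlaneTree.node cs).order = 1 + (cs.map PlaneTree.order).sum := by
  unfold PlaneTree.order
  rw [PlaneTree.degrees, Multiset.card_cons, add_comm]
  congr 1
  induction cs with
  | nil => simp
  | cons c cs ih => simp [ih]

theorem PlaneTree.order_pos (T : PlaneTree) : 1 ≤ T.order := by
  cases T with
  | node cs => rw [PlaneTree.order_node]; omega

theorem PlaneTree.finite_order_le (N : ℕ) : {T : PlaneTree | T.order ≤ N}.Finite := by
  induction N with
  | zero =>
    convert Set.finite_empty
    ext T
    have := T.order_pos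
    simp
    omega
  | succ N ih =>
    have : Finite {T : PlaneTree | T.order ≤ N} := ih
    refine ((List.finite_length_le {T : PlaneTree | T.order ≤ N} N).image
      (fun l => PlaneTree.node (l.map Subtype.val))).subset ?_
    rintro ⟨cs⟩ hT
    simp only [Set.mem_ofPred_eq, PlaneTree.order_node] at hT
    have h1 : ∀ c ∈ cs, c.order ≤ N := fun c hc => by
      have := List.le_sum_of_mem (List.mem_map_of_mem (f := PlaneTree.order) hc)
      omega
    have h2 : cs.length ≤ N := by
      have := List.card_nsmul_le_sum (cs.map PlaneTree.order) 1 (by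
        intro x hx
        obtain ⟨c, -, rfl⟩ := List.mem_map.1 hx
        exact c.order_pos)
      simp at this
      omega
    refine ⟨cs.attach.map (fun c => ⟨c.1, h1 c.1 c.2⟩), by simpa using h2, ?_⟩
    simp [List.map_map, Function.comp_def]

instance (D N : ℕ) : Finite (TreesOfOrder D N) :=
  ((PlaneTree.finite_order_le N).subset
    (fun _ hT => le_of_eq hT.1 : {T : PlaneTree | T.order = N ∧ T.Bounded D} ⊆ _)).to_subtype

noncomputable instance (D N : ℕ) : Fintype (TreesOfOrder D N) := Fintype.ofFinite _

/-- The energy `E(T) = ∑_{i=0}^{D} χ_i(T) E_i`. -/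
noncomputable def energy {D : ℕ} (E : Fin (D + 1) → ℝ) (T : PlaneTree) : ℝ :=
  ∑ i : Fin (D + 1), (T.chi i : ℝ) * E i

/-- The partition function `Z_N`. -/
noncomputable def partitionFunction {D : ℕ} (E : Fin (D + 1) → ℝ) (β : ℝ) (N : ℕ) : ℝ :=
  ∑ T : TreesOfOrder D N, Real.exp (-β * energy E T.1)

/-- The Gibbs measure `μ_N` on `𝕋_N(D)`, `μ_N {T} = exp (-β E(T)) / Z_N`. -/
noncomputable def gibbs {D : ℕ} (E : Fin (D + 1) → ℝ) (β : ℝ) (N : ℕ) :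
    Measure (TreesOfOrder D N) :=
  ∑ T : TreesOfOrder D N,
    ENNReal.ofReal (Real.exp (-β * energy E T.1) / partitionFunction E β N) • Measure.dirac T

instance {D : ℕ} (E : Fin (D + 1) → ℝ) (β : ℝ) (N : ℕ) : IsFiniteMeasure (gibbs E β N) := by
  refine ⟨?_⟩
  simp [gibbs, Measure.finsetSum_apply]

/-- The measure `μ_N π_{n,N}⁻¹` on `S_n`: the push-forward of the Gibbs measure under the radius-`n`
neighbourhood map, as a measure on `S_n`. (If some tree in `𝕋_N(D)` has height less than `n`, which
is possible only for small `N`, this discards the mass outside `S_n`.) -/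
noncomputable def rootLaw {D : ℕ} (E : Fin (D + 1) → ℝ) (β : ℝ) (n N : ℕ) :
    Measure (TreesOfHeight D n) :=
  ((gibbs E β N).map (fun T => PlaneTree.nbhd n T.1)).comap Subtype.val

instance {D : ℕ} (E : Fin (D + 1) → ℝ) (β : ℝ) (n N : ℕ) : IsFiniteMeasure (rootLaw E β n N) := by
  unfold rootLaw
  refine ⟨?_⟩
  rw [(⟨Subtype.val_injective, measurable_subtype_coe, fun {_} _ => MeasurableSpace.measurableSet_top⟩ :
    MeasurableEmbedding (Subtype.val : TreesOfHeight D n → PlaneTree)).comap_apply]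
  exact measure_lt_top _ _

/-- The total variation of the difference of two finite measures. -/
noncomputable def tvDist {α : Type*} [MeasurableSpace α] (μ ν : Measure α)
    [IsFiniteMeasure μ] [IsFiniteMeasure ν] : ENNReal :=
  (μ.toSignedMeasure - ν.toSignedMeasure).totalVariation Set.univ

/-! The Boltzmann weight of a tree is a product over its vertices, with weight `y i = exp (-β * E
i)` at out-degree `i`. Removing the root shows that the weighted generating function F solves F = X
φ(F), where φ(z) = ∑ y_i z^i. A tree with prescribed root neighbourhood S of radius n is S with an
arbitrary tree grafted at each vertex of level n. The generating function of these trees is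
therefore r X^m F^k, with r, m, k depending only on S (`fiberGF_eq_monomial`), and the mass of S is
r [X^(N-m)] F^k / [X^N] F.

By Lagrange inversion (`coeff_pow_eq_lagrangeCoeff`), [X^N] F^k = (k/N) [X^N] X^k φ^N. For D ≥ 2
there is s > 0 with s φ'(s) = φ(s), so p_i = y_i s^i / φ(s) is a probability law of mean one. The
coefficient is then, up to an explicit exponential factor, a point probability of a centred random
walk, and the local limit theorem (`tendsto_sqrt_mul_coeff`) makes it of order N^(-1/2), with a
constant independent of k. Hence [X^N] F^k ~ k s^k L τ^(-N) N^(-3/2), and the ratios converge.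

Since S_n is finite and the total mass is eventually one, convergence of the atoms is convergence in
total variation to a probability measure. For D = 1 no critical tilt exists, but S_n is a single
point. -/

/-! ### Generating functions of weighted families -/

open scoped Classical in
/-- The generating function of a weighted family, graded by `s`. -/
noncomputable def genFun {α : Type*} (s : α → ℕ) (w : α → ENNReal) : PowerSeries ENNReal :=
  PowerSeries.mk fun N => ∑' a, if s a = N then w a else 0

theorem genFun_of_injective {α β : Type*} {f : α → β} (hf : Function.Injective f) (s : β → ℕ)
    (w : β → ENNReal) (hw : ∀ b, w b ≠ 0 → b ∈ Set.range f) :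
    genFun s w = genFun (s ∘ f) (w ∘ f) := by
  ext N
  simp only [genFun, PowerSeries.coeff_mk]
  refine (hf.tsum_eq (f := fun b => if s b = N then w b else 0) ?_).symm
  intro b hb
  apply hw
  intro h
  simp [h] at hb

/-- Sums in `ENNReal` always converge and may be rearranged, so the Cauchy product needs no
finiteness of the graded pieces. -/
theorem genFun_mul {α β : Type*} (s : α → ℕ) (w : α → ENNReal) (t : β → ℕ) (v : β → ENNReal) :
    genFun s w * genFun t v = genFun (fun p : α × β => s p.1 + t p.2) (fun p => w p.1 * v p.2) := by
  ext N
  simp only [genFun, PowerSeries.coeff_mul, PowerSeries.coeff_mk]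
  have h : ∀ p : α × β, (if s p.1 + t p.2 = N then w p.1 * v p.2 else 0) =
      ∑ q ∈ Finset.HasAntidiagonal.antidiagonal N,
        (if s p.1 = q.1 then w p.1 else 0) * (if t p.2 = q.2 then v p.2 else 0) := by
    intro p
    split_ifs with hN
    · rw [Finset.sum_eq_single (s p.1, t p.2)]
      · simp
      · rintro ⟨a, b⟩ - hne
        by_cases h1 : s p.1 = a
        · by_cases h2 : t p.2 = b
          · exact absurd (by rw [h1, h2]) hne
          · simp [h2]
        · simp [h1]
      · intro h
        exact absurd (Finset.HasAntidiagonal.mem_antidiagonal.2 hN) h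
    · symm
      apply Finset.sum_eq_zero
      rintro ⟨a, b⟩ hab
      rw [Finset.HasAntidiagonal.mem_antidiagonal] at hab
      by_cases h1 : s p.1 = a
      · by_cases h2 : t p.2 = b
        · simp only at hab
          omega
        · simp [h2]
      · simp [h1]
  simp_rw [h]
  rw [Summable.tsum_finsetSum (fun _ _ => ENNReal.summable)]
  refine Finset.sum_congr rfl fun q _ => ?_
  rw [ENNReal.tsum_prod', ← ENNReal.tsum_mul_right]
  refine tsum_congr fun a => ?_
  exact ENNReal.tsum_mul_left.symm

theorem genFun_const_mul {α : Type*} (s : α → ℕ) (w : α → ENNReal) (r : ENNReal) :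
    genFun s (fun a => r * w a) = PowerSeries.C r * genFun s w := by
  ext N
  simp only [genFun, PowerSeries.coeff_C_mul, PowerSeries.coeff_mk]
  rw [← ENNReal.tsum_mul_left]
  simp

theorem genFun_one_add {α : Type*} (s : α → ℕ) (w : α → ENNReal) :
    genFun (fun a => 1 + s a) w = PowerSeries.X * genFun s w := by
  ext N
  cases N with
  | zero => simp [genFun]
  | succ N => simp [genFun, PowerSeries.coeff_succ_X_mul, add_comm 1]

theorem genFun_sum {α ι : Type*} (s : α → ℕ) (w : ι → α → ENNReal) (J : Finset ι) :
    genFun s (fun a => ∑ i ∈ J, w i a) = ∑ i ∈ J, genFun s (w i) := by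
  ext N
  simp only [genFun, map_sum, PowerSeries.coeff_mk]
  rw [← Summable.tsum_finsetSum (fun _ _ => ENNReal.summable)]
  refine tsum_congr fun a => ?_
  split_ifs <;> simp

theorem genFun_zero {α : Type*} (s : α → ℕ) : genFun s (fun _ => 0) = 0 := by
  ext N
  simp [genFun]

/-- The product weight of a list, position by position; zero if the lengths differ. -/
noncomputable def listWeight {α : Type*} : List (α → ENNReal) → List α → ENNReal
  | [], [] => 1
  | w :: ws, a :: l => w a * listWeight ws l
  | _, _ => 0

/-- A nonempty list is a head and a tail, so each position contributes one factor. The weights may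
vary with the position because the children of a root may have different prescribed neighbourhoods.
-/
theorem genFun_listWeight {α : Type*} (s : α → ℕ) (ws : List (α → ENNReal)) :
    genFun (fun l : List α => (l.map s).sum) (listWeight ws) = (ws.map (genFun s)).prod := by
  induction ws with
  | nil =>
    rw [genFun_of_injective (f := fun _ : Unit => ([] : List α)) (fun _ _ _ => rfl)]
    · ext N
      simp [genFun, listWeight, PowerSeries.coeff_one, eq_comm]
    · intro l hl
      cases l with
      | nil => exact ⟨(), rfl⟩
      | cons a l => simp [listWeight] at hl
  | cons w ws ih =>
    rw [List.map_cons, List.prod_cons, ← ih, genFun_mul,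
      genFun_of_injective (f := fun p : α × List α => p.1 :: p.2)]
    · congr 1
    · rintro ⟨a, l⟩ ⟨b, m⟩ h
      simpa using h
    · intro l hl
      cases l with
      | nil => simp [listWeight] at hl
      | cons a l => exact ⟨(a, l), rfl⟩

open scoped Classical in
theorem listWeight_replicate {α : Type*} (w : α → ENNReal) (i : ℕ) (l : List α) :
    listWeight (List.replicate i w) l = if l.length = i then (l.map w).prod else 0 := by
  induction i generalizing l with
  | zero => cases l <;> simp [listWeight]
  | succ i ih => cases l <;> simp [listWeight, List.replicate_succ, ih]

/-! ### Functional equation of the tree series and series of the fibres of `nbhd` -/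

namespace PlaneTree

/-- The multiplicative weight of a tree whose vertices of out-degree `i` have weight `x i`. -/
noncomputable def weight (x : ℕ → ENNReal) (T : PlaneTree) : ENNReal := (T.degrees.map x).prod

theorem weight_node (x : ℕ → ENNReal) (cs : List PlaneTree) :
    (node cs).weight x = x cs.length * (cs.map (weight x)).prod := by
  unfold weight
  rw [degrees, Multiset.map_cons, Multiset.prod_cons]
  congr 1
  induction cs with
  | nil => simp
  | cons c cs ih => simp [ih]

theorem node_bijective : Function.Bijective node :=
  ⟨fun _ _ h => node.inj h, fun ⟨cs⟩ => ⟨cs, rfl⟩⟩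

/-- The weighted generating function of all plane trees. -/
noncomputable def gf (x : ℕ → ENNReal) : PowerSeries ENNReal := genFun order (weight x)

open scoped Classical in
/-- The weighted generating function of the trees with a given neighbourhood of the root. -/
noncomputable def fiberGF (x : ℕ → ENNReal) (n : ℕ) (S : PlaneTree) : PowerSeries ENNReal :=
  genFun order (fun T => if nbhd n T = S then weight x T else 0)

theorem genFun_order_eq (w : PlaneTree → ENNReal) :
    genFun order w =
      PowerSeries.X * genFun (fun cs : List PlaneTree => (cs.map order).sum) (w ∘ node) := by
  rw [genFun_of_injective node_bijective.1 _ _ (fun b _ => node_bijective.2 b), ← genFun_one_add]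
  congr 1
  funext cs
  exact order_node cs

theorem gf_eq (x : ℕ → ENNReal) (D : ℕ) (hx : ∀ i, D < i → x i = 0) :
    gf x = PowerSeries.X * ∑ i ∈ Finset.range (D + 1), PowerSeries.C (x i) * gf x ^ i := by
  classical
  conv_lhs => rw [gf, genFun_order_eq]
  congr 1
  have h : ∀ cs : List PlaneTree, (weight x ∘ node) cs =
      ∑ i ∈ Finset.range (D + 1), x i * listWeight (List.replicate i (weight x)) cs := by
    intro cs
    simp only [listWeight_replicate, Function.comp, weight_node, mul_ite, mul_zero]
    rw [Finset.sum_ite_eq]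
    split_ifs with h
    · rfl
    · rw [hx _ (by simpa using h), zero_mul]
  rw [funext h, genFun_sum]
  refine Finset.sum_congr rfl fun i _ => ?_
  rw [genFun_const_mul, genFun_listWeight]
  simp [gf]

open scoped Classical in
theorem ite_map_nbhd_eq (x : ℕ → ENNReal) (n : ℕ) (Ss cs : List PlaneTree) :
    (if cs.map (nbhd n) = Ss then (cs.map (weight x)).prod else 0) =
      listWeight (Ss.map fun S T => if nbhd n T = S then weight x T else 0) cs := by
  induction Ss generalizing cs with
  | nil => cases cs <;> simp [listWeight]
  | cons S Ss ih =>
    cases cs with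
    | nil => simp [listWeight]
    | cons c cs =>
      simp only [List.map_cons, listWeight, ← ih, List.cons.injEq, List.prod_cons]
      split_ifs <;> simp_all

theorem fiberGF_succ (x : ℕ → ENNReal) (n : ℕ) (Ss : List PlaneTree) :
    fiberGF x (n + 1) (node Ss) =
      PowerSeries.X * (PowerSeries.C (x Ss.length) * (Ss.map (fiberGF x n)).prod) := by
  classical
  rw [fiberGF, genFun_order_eq]
  congr 1
  have h : ((fun T => if nbhd (n + 1) T = node Ss then weight x T else 0) ∘ node) =
      fun cs => x Ss.length *
        listWeight (Ss.map fun S T => if nbhd n T = S then weight x T else 0) cs := by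
    funext cs
    rw [← ite_map_nbhd_eq]
    simp only [Function.comp, nbhd, node.injEq, weight_node]
    split_ifs with h
    · rw [← h, List.length_map]
    · simp
  rw [h, genFun_const_mul, genFun_listWeight, List.map_map]
  rfl

theorem fiberGF_zero (x : ℕ → ENNReal) (S : PlaneTree) :
    fiberGF x 0 S = gf x ∨ fiberGF x 0 S = 0 := by
  by_cases h : node [] = S
  · left
    simp [fiberGF, nbhd, h, gf]
  · right
    simp [fiberGF, nbhd, h, genFun_zero]

/-- When S is a possible neighbourhood, m counts its vertices at distance less than n from the root,
r is the product of their weights, and k counts the vertices at distance n, each carrying an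
arbitrary tree. Otherwise r = 0 serves. -/
theorem fiberGF_eq_monomial (x : ℕ → ENNReal) (hx : ∀ i, x i ≠ ⊤) (n : ℕ) (S : PlaneTree) :
    ∃ (r : ENNReal) (m k : ℕ), r ≠ ⊤ ∧
      fiberGF x n S = PowerSeries.C r * PowerSeries.X ^ m * gf x ^ k := by
  induction n generalizing S with
  | zero =>
    rcases fiberGF_zero x S with h | h
    · exact ⟨1, 0, 1, by simp, by simp [h]⟩
    · exact ⟨0, 0, 0, by simp, by simp [h]⟩
  | succ n ih =>
    obtain ⟨Ss⟩ := S
    have key : ∀ L : List PlaneTree, ∃ (r : ENNReal) (m k : ℕ), r ≠ ⊤ ∧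
        (L.map (fiberGF x n)).prod = PowerSeries.C r * PowerSeries.X ^ m * gf x ^ k := by
      intro L
      induction L with
      | nil => exact ⟨1, 0, 0, by simp, by simp⟩
      | cons c L ihL =>
        obtain ⟨r, m, k, hr, h⟩ := ihL
        obtain ⟨r', m', k', hr', h'⟩ := ih c
        refine ⟨r' * r, m' + m, k' + k, ENNReal.mul_ne_top hr' hr, ?_⟩
        rw [List.map_cons, List.prod_cons, h, h', map_mul]
        ring
    obtain ⟨r, m, k, hr, h⟩ := key Ss
    refine ⟨x Ss.length * r, m + 1, k, ENNReal.mul_ne_top (hx _) hr, ?_⟩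
    rw [fiberGF_succ, h, map_mul]
    ring

end PlaneTree

/-! ### Lagrange inversion through a recursion -/

/-- The coefficients of the powers of the solution of `F = X φ(F)`. -/
noncomputable def lagrangeCoeff (φ : Polynomial ℝ) (k N : ℕ) : ℝ :=
  if N = 0 then (if k = 0 then 1 else 0)
  else (k : ℝ) / N * (Polynomial.X ^ k * φ ^ N).coeff N

-- This is the recursion that F^(k+1) = X ∑ y_i F^(k+i) imposes on coefficients. With a = [X^N] X^k
-- φ^(N+1) and b = [X^N] X^k φ^N (X φ'), two relations express everything through a and b, and b is
-- then eliminated. The case N = 0 is apart because `lagrangeCoeff` is not given by the quotient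
-- there.
open Polynomial in
theorem lagrangeCoeff_succ_succ (y : ℕ → ℝ) (D k N : ℕ) :
    lagrangeCoeff (∑ i ∈ Finset.range (D + 1), C (y i) * X ^ i) (k + 1) (N + 1) =
      ∑ i ∈ Finset.range (D + 1), y i *
        lagrangeCoeff (∑ i ∈ Finset.range (D + 1), C (y i) * X ^ i) (k + i) N := by
  set φ : ℝ[X] := ∑ i ∈ Finset.range (D + 1), C (y i) * X ^ i with hφ
  have hcoeff : (X ^ (k + 1) * φ ^ (N + 1)).coeff (N + 1) = (X ^ k * φ ^ (N + 1)).coeff N := by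
    rw [pow_succ' X k, mul_assoc, coeff_X_mul]
  rcases Nat.eq_zero_or_pos N with rfl | hN
  · simp only [lagrangeCoeff, hcoeff]
    rcases Nat.eq_zero_or_pos k with rfl | hk
    · simp [hφ, Finset.sum_range_succ', coeff_zero_eq_eval_zero, eval_finsetSum]
    · have h0 : (0 : ℕ) ≠ k := hk.ne
      simp [h0, hk.ne']
  · have hderiv : X * derivative φ = ∑ i ∈ Finset.range (D + 1), C (y i * i) * X ^ i := by
      rw [hφ, derivative_sum, Finset.mul_sum]
      refine Finset.sum_congr rfl fun i _ => ?_
      rw [derivative_C_mul_X_pow]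
      rcases i with _ | i
      · simp
      · rw [Nat.add_sub_cancel, pow_succ]
        ring
    -- The operator X d/dX multiplies the coefficient of X^N by N; apply it to X^k φ^(N+1).
    have h1 : (N : ℝ) * (X ^ k * φ ^ (N + 1)).coeff N = k * (X ^ k * φ ^ (N + 1)).coeff N +
        (N + 1) * (X ^ k * φ ^ N * (X * derivative φ)).coeff N := by
      have e : X * derivative (X ^ k * φ ^ (N + 1)) = C (k : ℝ) * (X ^ k * φ ^ (N + 1)) +
          C ((N : ℝ) + 1) * (X ^ k * φ ^ N * (X * derivative φ)) := by
        rw [derivative_mul, derivative_X_pow, derivative_pow]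
        rcases k with _ | k
        · simp
          ring
        · simp
          ring
      have := congrArg (fun p => p.coeff N) e
      simp only [coeff_add, coeff_C_mul] at this
      rw [← this]
      obtain ⟨M, rfl⟩ : ∃ M, N = M + 1 := ⟨N - 1, by omega⟩
      rw [coeff_X_mul, coeff_derivative]
      push_cast
      ring
    have h2 : ∑ i ∈ Finset.range (D + 1), y i * ((k + i : ℕ) * (X ^ (k + i) * φ ^ N).coeff N) =
        k * (X ^ k * φ ^ (N + 1)).coeff N + (X ^ k * φ ^ N * (X * derivative φ)).coeff N := by
      have e : C (k : ℝ) * (X ^ k * φ ^ (N + 1)) + X ^ k * φ ^ N * (X * derivative φ) =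
          ∑ i ∈ Finset.range (D + 1), C (y i * (k + i : ℕ)) * (X ^ (k + i) * φ ^ N) := by
        rw [hderiv, pow_succ φ N]
        conv_lhs => enter [1, 2, 2, 2]; rw [hφ]
        simp only [Finset.mul_sum]
        rw [← Finset.sum_add_distrib]
        refine Finset.sum_congr rfl fun i _ => ?_
        simp only [map_mul, Nat.cast_add, map_add, pow_add]
        ring
      have := congrArg (fun p => p.coeff N) e
      simp only [coeff_add, coeff_C_mul, finsetSum_coeff] at this
      rw [this]
      refine Finset.sum_congr rfl fun i _ => ?_
      ring
    have hN' : (N : ℝ) ≠ 0 := by positivity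
    have h3 : ∀ i, y i * lagrangeCoeff φ (k + i) N =
        (y i * ((k + i : ℕ) * (X ^ (k + i) * φ ^ N).coeff N)) / N := by
      intro i
      rw [lagrangeCoeff, if_neg hN.ne']
      ring
    rw [Finset.sum_congr rfl fun i _ => h3 i, ← Finset.sum_div, h2, lagrangeCoeff,
      if_neg (by omega), hcoeff]
    push_cast
    field_simp
    linear_combination h1

open Polynomial in
theorem coeff_mul_pow_nonneg (y : ℕ → ℝ) (hy : ∀ i, 0 ≤ y i) (D k N j : ℕ) :
    0 ≤ (X ^ k * (∑ i ∈ Finset.range (D + 1), C (y i) * X ^ i) ^ N).coeff j := by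
  have hmul : ∀ p q : ℝ[X], (∀ j, 0 ≤ p.coeff j) → (∀ j, 0 ≤ q.coeff j) →
      ∀ j, 0 ≤ (p * q).coeff j := by
    intro p q hp hq j
    rw [coeff_mul]
    exact Finset.sum_nonneg fun _ _ => mul_nonneg (hp _) (hq _)
  revert j
  apply hmul
  · intro j
    rw [coeff_X_pow]
    positivity
  · induction N with
    | zero =>
      intro j
      rw [pow_zero, coeff_one]
      positivity
    | succ N ih =>
      rw [pow_succ]
      refine hmul _ _ ih fun j => ?_
      rw [finsetSum_coeff]
      refine Finset.sum_nonneg fun i _ => ?_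
      rw [coeff_C_mul, coeff_X_pow]
      have := hy i
      positivity

theorem lagrangeCoeff_nonneg (y : ℕ → ℝ) (hy : ∀ i, 0 ≤ y i) (D k N : ℕ) :
    0 ≤ lagrangeCoeff (∑ i ∈ Finset.range (D + 1), Polynomial.C (y i) * Polynomial.X ^ i) k N := by
  unfold lagrangeCoeff
  have := coeff_mul_pow_nonneg y hy D k N N
  positivity

/-- **Lagrange inversion** for a polynomial with nonnegative coefficients. -/
theorem coeff_pow_eq_lagrangeCoeff (y : ℕ → ℝ) (hy : ∀ i, 0 ≤ y i) (D : ℕ)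
    (F : PowerSeries ENNReal)
    (hF : F = PowerSeries.X * ∑ i ∈ Finset.range (D + 1),
      PowerSeries.C (ENNReal.ofReal (y i)) * F ^ i) (k N : ℕ) :
    PowerSeries.coeff N (F ^ k) = ENNReal.ofReal (lagrangeCoeff
      (∑ i ∈ Finset.range (D + 1), Polynomial.C (y i) * Polynomial.X ^ i) k N) := by
  -- Multiplying the equation by F^k gives a recursion that, with the values at N = 0 and k = 0,
  -- determines all coefficients. It involves no subtraction, so it works over `ENNReal`.
  have hpow : ∀ k, F ^ (k + 1) = PowerSeries.X * ∑ i ∈ Finset.range (D + 1),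
      PowerSeries.C (ENNReal.ofReal (y i)) * F ^ (k + i) := by
    intro k
    rw [pow_succ]
    nth_rewrite 2 [hF]
    rw [Finset.mul_sum, Finset.mul_sum, Finset.mul_sum]
    refine Finset.sum_congr rfl fun i _ => ?_
    ring
  induction N generalizing k with
  | zero =>
    cases k with
    | zero => simp [lagrangeCoeff]
    | succ k =>
      rw [hpow]
      simp [lagrangeCoeff]
  | succ N ih =>
    cases k with
    | zero => simp [lagrangeCoeff, PowerSeries.coeff_one]
    | succ k =>
      rw [hpow, PowerSeries.coeff_succ_X_mul, lagrangeCoeff_succ_succ,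
        ENNReal.ofReal_sum_of_nonneg
          fun i _ => mul_nonneg (hy i) (lagrangeCoeff_nonneg y hy D _ _), map_sum]
      refine Finset.sum_congr rfl fun i _ => ?_
      rw [PowerSeries.coeff_C_mul, ih, ENNReal.ofReal_mul (hy i)]

/-! ### Fourier inversion and the local limit theorem -/

theorem integral_exp_int_mul (j : ℤ) :
    ∫ t in -Real.pi..Real.pi, Complex.exp (Complex.I * j * (t : ℂ)) =
      if j = 0 then 2 * (Real.pi : ℂ) else 0 := by
  split_ifs with h
  · simp [h]
    ring
  · have hc : Complex.I * j ≠ 0 := mul_ne_zero Complex.I_ne_zero (by exact_mod_cast h)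
    rw [integral_exp_mul_complex hc, div_eq_zero_iff]
    left
    rw [sub_eq_zero, Complex.exp_eq_exp_iff_exists_int]
    refine ⟨j, ?_⟩
    push_cast
    ring

open Polynomial in
/-- The coefficients of a polynomial as Fourier coefficients. -/
theorem two_pi_mul_coeff (p : ℝ[X]) (j : ℕ) :
    2 * (Real.pi : ℂ) * (p.coeff j : ℂ) = ∫ t in -Real.pi..Real.pi,
      Complex.exp (-(Complex.I * j * (t : ℂ))) * aeval (Complex.exp (Complex.I * (t : ℂ))) p := by
  have h : ∀ t : ℝ, Complex.exp (-(Complex.I * j * (t : ℂ))) *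
      aeval (Complex.exp (Complex.I * (t : ℂ))) p =
      ∑ i ∈ p.support, (p.coeff i : ℂ) *
        Complex.exp (Complex.I * ((i : ℤ) - (j : ℤ) : ℤ) * (t : ℂ)) := by
    intro t
    rw [aeval_def, eval₂_eq_sum, sum_def, Finset.mul_sum]
    refine Finset.sum_congr rfl fun i _ => ?_
    rw [← Complex.exp_nat_mul, mul_left_comm, ← Complex.exp_add]
    congr 2
    push_cast
    ring
  simp_rw [h]
  rw [intervalIntegral.integral_finsetSum]
  · simp_rw [intervalIntegral.integral_const_mul, integral_exp_int_mul]
    simp only [sub_eq_zero, Nat.cast_inj, mul_ite, mul_zero, Finset.sum_ite_eq', mem_support_iff]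
    split_ifs with hj
    · ring
    · rw [not_not] at hj
      simp [hj]
  · intro i _
    apply Continuous.intervalIntegrable
    fun_prop

/-- The characteristic function of a step distribution on `-1, 0, 1, …, D - 1`. -/
noncomputable def stepChar (p : ℕ → ℝ) (D : ℕ) (t : ℝ) : ℂ :=
  ∑ i ∈ Finset.range (D + 1), (p i : ℂ) * Complex.exp (Complex.I * ((i : ℝ) - 1 : ℝ) * t)

theorem continuous_stepChar (p : ℕ → ℝ) (D : ℕ) : Continuous (stepChar p D) := by
  unfold stepChar
  fun_prop

-- The Fourier factor e^(-iNt) is shared out as one e^(-it) for each factor of the N-th power, which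
-- centres the steps at i - 1.
open Polynomial in
theorem two_pi_mul_coeff_mul_pow (p : ℕ → ℝ) (D k N : ℕ) :
    2 * (Real.pi : ℂ) *
      ((X ^ k * (∑ i ∈ Finset.range (D + 1), C (p i) * X ^ i) ^ N : ℝ[X]).coeff N : ℂ) =
    ∫ t in -Real.pi..Real.pi, Complex.exp (Complex.I * k * (t : ℂ)) * stepChar p D t ^ N := by
  rw [two_pi_mul_coeff]
  refine intervalIntegral.integral_congr fun t _ => ?_
  have h : stepChar p D t = Complex.exp (-(Complex.I * t)) *
      aeval (Complex.exp (Complex.I * (t : ℂ))) (∑ i ∈ Finset.range (D + 1), C (p i) * X ^ i) := by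
    rw [stepChar, map_sum, Finset.mul_sum]
    refine Finset.sum_congr rfl fun i _ => ?_
    simp only [map_mul, map_pow, aeval_C, aeval_X, Complex.coe_algebraMap]
    rw [← Complex.exp_nat_mul, mul_left_comm, ← Complex.exp_add]
    congr 2
    push_cast
    ring
  simp only [h, map_mul, map_pow, aeval_X, mul_pow, ← Complex.exp_nat_mul]
  rw [← mul_assoc, ← mul_assoc, ← Complex.exp_add, ← mul_assoc, ← Complex.exp_add]
  congr 2
  ring

theorem norm_exp_I_mul_mul (a t : ℝ) : ‖Complex.exp (Complex.I * a * t)‖ = 1 := by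
  rw [mul_assoc, mul_comm, ← Complex.ofReal_mul, Complex.norm_exp_ofReal_mul_I]

/-- The squared norm is a² + b² + 2ab cos t, and cos t ≤ 1 - 2t²/π² on [-π, π]; a + b ≤ 1 lets the
square root be taken. -/
theorem norm_add_mul_exp_le {a b : ℝ} (ha : 0 < a) (hb : 0 < b) (hab : a + b ≤ 1) {t : ℝ}
    (ht : |t| ≤ Real.pi) :
    ‖(a : ℂ) * Complex.exp (Complex.I * (-1 : ℝ) * t) + b‖ ≤
      a + b - 2 * a * b / Real.pi ^ 2 * t ^ 2 := by
  have hcos := Real.cos_le_one_sub_mul_cos_sq ht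
  have hpi := Real.pi_pos
  have ht2 : t ^ 2 ≤ Real.pi ^ 2 := by
    rw [← sq_abs]
    gcongr
  set u : ℝ := t ^ 2 / Real.pi ^ 2 with hu
  have hu1 : u ≤ 1 := by
    rw [hu, div_le_one (by positivity)]
    exact ht2
  have hu0 : 0 ≤ u := by positivity
  have hcos' : Real.cos t ≤ 1 - 2 * u := by
    calc _ ≤ _ := hcos
      _ = _ := by rw [hu]; ring
  have hgoal : a + b - 2 * a * b / Real.pi ^ 2 * t ^ 2 = a + b - 2 * a * b * u := by
    rw [hu]
    ring
  rw [hgoal]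
  have hnn : 0 ≤ a + b - 2 * a * b * u := by
    have : a * b * u ≤ a * b := mul_le_of_le_one_right (by positivity) hu1
    nlinarith
  have hnorm : ‖(a : ℂ) * Complex.exp (Complex.I * (-1 : ℝ) * t) + b‖ ^ 2 =
      a ^ 2 + b ^ 2 + 2 * a * b * Real.cos t := by
    have e : Complex.I * (-1 : ℝ) * t = ((-t : ℝ) : ℂ) * Complex.I := by
      push_cast
      ring
    rw [e, ← Complex.normSq_eq_norm_sq, Complex.normSq_apply]
    simp only [Complex.add_re, Complex.add_im, Complex.mul_re, Complex.mul_im, Complex.ofReal_re,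
      Complex.ofReal_im, Complex.exp_ofReal_mul_I_re, Complex.exp_ofReal_mul_I_im, Real.cos_neg,
      Real.sin_neg]
    linear_combination a ^ 2 * Real.sin_sq_add_cos_sq t
  refine abs_le_of_sq_le_sq' ?_ hnn |>.2
  rw [hnorm]
  have h1 : 2 * a * b * Real.cos t ≤ 2 * a * b * (1 - 2 * u) := by gcongr
  have h2 : 4 * a * b * u * (a + b) ≤ 4 * a * b * u * 1 := by gcongr
  nlinarith [sq_nonneg (2 * a * b * u)]

/-- Aperiodicity: the adjacent steps -1 and 0 both have positive mass, and their interference alone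
gives a Gaussian bound on the whole period. The other steps are bounded trivially. -/
theorem norm_stepChar_le {p : ℕ → ℝ} {D : ℕ} (hp : ∀ i, 0 ≤ p i) (hD : 1 ≤ D)
    (hsum : ∑ i ∈ Finset.range (D + 1), p i = 1) (h0 : 0 < p 0) (h1 : 0 < p 1) {t : ℝ}
    (ht : |t| ≤ Real.pi) :
    ‖stepChar p D t‖ ≤ Real.exp (-(2 * p 0 * p 1 / Real.pi ^ 2) * t ^ 2) := by
  obtain ⟨d, rfl⟩ : ∃ d, D = d + 1 := ⟨D - 1, by omega⟩
  rw [Finset.sum_range_succ', Finset.sum_range_succ'] at hsum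
  have hR : 0 ≤ ∑ i ∈ Finset.range d, p (i + 1 + 1) := Finset.sum_nonneg fun _ _ => hp _
  have hmain : stepChar p (d + 1) t =
      ∑ i ∈ Finset.range d,
        (p (i + 1 + 1) : ℂ) * Complex.exp (Complex.I * (((i + 1 + 1 : ℕ) : ℝ) - 1 : ℝ) * t) +
      ((p 0 : ℂ) * Complex.exp (Complex.I * (-1 : ℝ) * t) + p 1) := by
    rw [stepChar, Finset.sum_range_succ', Finset.sum_range_succ']
    simp
    ring
  have hrest : ‖∑ i ∈ Finset.range d,
      (p (i + 1 + 1) : ℂ) * Complex.exp (Complex.I * (((i + 1 + 1 : ℕ) : ℝ) - 1 : ℝ) * t)‖ ≤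
      ∑ i ∈ Finset.range d, p (i + 1 + 1) := by
    refine (norm_sum_le _ _).trans (Finset.sum_le_sum fun i _ => ?_)
    rw [norm_mul, norm_exp_I_mul_mul, mul_one, Complex.norm_real, Real.norm_of_nonneg (hp _)]
  have hfirst := norm_add_mul_exp_le h0 h1 (by simp at hsum; linarith) ht
  have hexp := Real.add_one_le_exp (-(2 * p 0 * p 1 / Real.pi ^ 2) * t ^ 2)
  rw [hmain]
  refine (norm_add_le _ _).trans ?_
  simp only [zero_add] at hsum
  linarith

theorem tendsto_nat_mul_exp_sub (a : ℝ) :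
    Tendsto (fun N : ℕ => (N : ℂ) *
      (Complex.exp (Complex.I * a * ((√N)⁻¹ : ℝ)) - 1 - Complex.I * a * ((√N)⁻¹ : ℝ)))
      atTop (𝓝 (-(a ^ 2 / 2 : ℝ))) := by
  rw [tendsto_iff_norm_sub_tendsto_zero]
  have hlim : Tendsto (fun N : ℕ => |a| ^ 3 * Real.exp |a| * (√N)⁻¹) atTop (𝓝 0) := by
    rw [← mul_zero (|a| ^ 3 * Real.exp |a|)]
    exact (tendsto_inv_atTop_zero.comp
      (Real.tendsto_sqrt_atTop.comp tendsto_natCast_atTop_atTop)).const_mul _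
  refine squeeze_zero' (Eventually.of_forall fun _ => norm_nonneg _) ?_ hlim
  filter_upwards [eventually_ge_atTop 1] with N hN
  have hs1 : 1 ≤ √(N : ℝ) := by
    rw [Real.one_le_sqrt]
    exact_mod_cast hN
  have hs : 0 < √(N : ℝ) := by linarith
  have hsq : √(N : ℝ) ^ 2 = N := Real.sq_sqrt (by positivity)
  set s := √(N : ℝ) with hsdef
  have hb := Complex.norm_exp_sub_sum_le_norm_mul_exp (Complex.I * a * (s⁻¹ : ℝ)) 3
  have hn : ‖Complex.I * a * (s⁻¹ : ℝ)‖ = |a| * s⁻¹ := by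
    rw [norm_mul, norm_mul, Complex.norm_I, Complex.norm_real, Complex.norm_real, one_mul,
      Real.norm_eq_abs, Real.norm_of_nonneg (by positivity)]
  rw [hn] at hb
  have hNc : (N : ℂ) = (s : ℂ) ^ 2 := by
    rw [← Complex.ofReal_pow, hsq]
    simp
  have hsc : (s : ℂ) ≠ 0 := by exact_mod_cast hs.ne'
  have heq : (N : ℂ) * (Complex.exp (Complex.I * a * (s⁻¹ : ℝ)) - 1 - Complex.I * a * (s⁻¹ : ℝ)) -
      (-(a ^ 2 / 2 : ℝ) : ℂ) = (s : ℂ) ^ 2 * (Complex.exp (Complex.I * a * (s⁻¹ : ℝ)) -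
        ∑ m ∈ Finset.range 3, (Complex.I * a * (s⁻¹ : ℝ)) ^ m / m.factorial) := by
    rw [hNc]
    simp only [Finset.sum_range_succ, Finset.sum_range_zero]
    simp
    field_simp
    rw [Complex.I_sq]
    ring
  rw [heq, norm_mul, norm_pow, Complex.norm_real, Real.norm_of_nonneg hs.le]
  calc s ^ 2 * _ ≤ s ^ 2 * ((|a| * s⁻¹) ^ 3 * Real.exp (|a| * s⁻¹)) := by gcongr
    _ ≤ s ^ 2 * ((|a| * s⁻¹) ^ 3 * Real.exp |a|) := by
      gcongr
      exact mul_le_of_le_one_right (abs_nonneg _) (inv_le_one_of_one_le₀ hs1)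
    _ = _ := by field_simp

/-- Central limit theorem: mean zero cancels the first-order Taylor term, and the second-order term,
multiplied by N, converges to minus half the variance times x². -/
theorem tendsto_stepChar_pow {p : ℕ → ℝ} {D : ℕ}
    (hsum : ∑ i ∈ Finset.range (D + 1), p i = 1)
    (hmean : ∑ i ∈ Finset.range (D + 1), p i * ((i : ℝ) - 1) = 0) (x : ℝ) :
    Tendsto (fun N : ℕ => stepChar p D (x * (√N)⁻¹) ^ N) atTop
      (𝓝 (Real.exp (-((∑ i ∈ Finset.range (D + 1), p i * ((i : ℝ) - 1) ^ 2) / 2) * x ^ 2) : ℝ)) := by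
  have key : Tendsto (fun N : ℕ => (N : ℂ) * (stepChar p D (x * (√N)⁻¹) - 1)) atTop
      (𝓝 ((-((∑ i ∈ Finset.range (D + 1), p i * ((i : ℝ) - 1) ^ 2) / 2) * x ^ 2 : ℝ) : ℂ)) := by
    have h : ∀ N : ℕ, (N : ℂ) * (stepChar p D (x * (√N)⁻¹) - 1) =
        ∑ i ∈ Finset.range (D + 1), (p i : ℂ) * ((N : ℂ) *
          (Complex.exp (Complex.I * (((i : ℝ) - 1) * x : ℝ) * ((√N)⁻¹ : ℝ)) - 1 -
            Complex.I * (((i : ℝ) - 1) * x : ℝ) * ((√N)⁻¹ : ℝ))) := by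
      intro N
      have e1 : (∑ i ∈ Finset.range (D + 1), (p i : ℂ)) = 1 := by exact_mod_cast hsum
      have e2 : (∑ i ∈ Finset.range (D + 1), (p i : ℂ) * ((i : ℂ) - 1)) = 0 := by
        exact_mod_cast hmean
      have e3 : ∀ i ∈ Finset.range (D + 1), (p i : ℂ) * ((N : ℂ) *
          (Complex.exp (Complex.I * (((i : ℝ) - 1) * x : ℝ) * ((√N)⁻¹ : ℝ)) - 1 -
            Complex.I * (((i : ℝ) - 1) * x : ℝ) * ((√N)⁻¹ : ℝ))) =
          (N : ℂ) * ((p i : ℂ) * Complex.exp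
            (Complex.I * ((i : ℝ) - 1 : ℝ) * (x * (√N)⁻¹ : ℝ))) - (N : ℂ) * (p i : ℂ) -
          (N : ℂ) * (Complex.I * x * ((√N)⁻¹ : ℝ)) * ((p i : ℂ) * ((i : ℂ) - 1)) := by
        intro i _
        have : Complex.I * (((i : ℝ) - 1) * x : ℝ) * ((√N)⁻¹ : ℝ) =
            Complex.I * ((i : ℝ) - 1 : ℝ) * (x * (√N)⁻¹ : ℝ) := by
          push_cast
          ring
        rw [this]
        push_cast
        ring
      rw [Finset.sum_congr rfl e3, Finset.sum_sub_distrib, Finset.sum_sub_distrib,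
        ← Finset.mul_sum, ← Finset.mul_sum, ← Finset.mul_sum, e1, e2, stepChar]
      ring
    simp_rw [h]
    have hlim := tendsto_finsetSum (Finset.range (D + 1)) fun i _ =>
      (tendsto_nat_mul_exp_sub (((i : ℝ) - 1) * x)).const_mul (p i : ℂ)
    convert hlim using 2
    push_cast
    rw [Finset.sum_div, neg_mul, Finset.sum_mul, ← Finset.sum_neg_distrib]
    refine Finset.sum_congr rfl fun i _ => ?_
    ring
  have := Complex.tendsto_one_add_pow_exp_of_tendsto key
  simp only [add_sub_cancel] at this
  rwa [Complex.ofReal_exp]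

open Polynomial in
/-- **Local limit theorem** at the mean for a step distribution of mean one on `0, …, D`. -/
theorem tendsto_sqrt_mul_coeff {p : ℕ → ℝ} {D : ℕ} (hp : ∀ i, 0 ≤ p i) (hD : 1 ≤ D)
    (hsum : ∑ i ∈ Finset.range (D + 1), p i = 1)
    (hmean : ∑ i ∈ Finset.range (D + 1), p i * ((i : ℝ) - 1) = 0)
    (h0 : 0 < p 0) (h1 : 0 < p 1) :
    ∃ L : ℝ, 0 < L ∧ ∀ k : ℕ, Tendsto (fun N : ℕ => √N *
      (X ^ k * (∑ i ∈ Finset.range (D + 1), C (p i) * X ^ i) ^ N : ℝ[X]).coeff N)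
      atTop (𝓝 L) := by
  set v : ℝ := (∑ i ∈ Finset.range (D + 1), p i * ((i : ℝ) - 1) ^ 2) / 2 with hv
  have hvpos : 0 < v := by
    have : p 0 * (((0 : ℕ) : ℝ) - 1) ^ 2 ≤
        ∑ i ∈ Finset.range (D + 1), p i * ((i : ℝ) - 1) ^ 2 :=
      Finset.single_le_sum (f := fun i : ℕ => p i * ((i : ℝ) - 1) ^ 2)
        (fun i _ => mul_nonneg (hp i) (sq_nonneg _)) (by simp)
    norm_num at this
    linarith
  have hpi := Real.pi_pos
  -- Here √(π / v) is the Gaussian integral. The limit is independent of k because exp(ikx/√N) tends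
  -- to 1.
  refine ⟨(2 * Real.pi)⁻¹ * √(Real.pi / v), by positivity, fun k => ?_⟩
  set c : ℝ := 2 * p 0 * p 1 / Real.pi ^ 2 with hc
  have hcpos : 0 < c := by positivity
  -- The Fourier integrand after t = x/√N, extended by zero; `norm_stepChar_le` dominates it by
  -- exp(-c x²).
  let G : ℕ → ℝ → ℂ := fun N => (Set.Ioc (-(Real.pi * √N)) (Real.pi * √N)).indicator
    (fun x => Complex.exp (Complex.I * k * ((x * (√N)⁻¹ : ℝ) : ℂ)) *
      stepChar p D (x * (√N)⁻¹) ^ N)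
  have hG : Tendsto (fun N => ∫ x, G N x) atTop (𝓝 (∫ x, ((Real.exp (-v * x ^ 2) : ℝ) : ℂ))) := by
    refine tendsto_integral_filter_of_dominated_convergence (fun x => Real.exp (-c * x ^ 2))
      ?_ ?_ (integrable_exp_neg_mul_sq hcpos) ?_
    · refine Eventually.of_forall fun N => ?_
      refine (Continuous.aestronglyMeasurable ?_).indicator measurableSet_Ioc
      have := continuous_stepChar p D
      fun_prop
    · filter_upwards [eventually_ge_atTop 1] with N hN
      refine Eventually.of_forall fun x => ?_
      have hs : 0 < √(N : ℝ) := Real.sqrt_pos.2 (by exact_mod_cast hN)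
      by_cases hx : x ∈ Set.Ioc (-(Real.pi * √N)) (Real.pi * √N)
      · simp only [G, Set.indicator_of_mem hx]
        have ht : |x * (√N)⁻¹| ≤ Real.pi := by
          rw [← div_eq_mul_inv, abs_div, abs_of_pos hs, div_le_iff₀ hs]
          exact abs_le.2 ⟨hx.1.le, hx.2⟩
        have hk : ‖Complex.exp (Complex.I * k * ((x * (√N)⁻¹ : ℝ) : ℂ))‖ = 1 := by
          exact_mod_cast norm_exp_I_mul_mul k (x * (√N)⁻¹)
        rw [norm_mul, norm_pow, hk, one_mul]
        calc _ ≤ Real.exp (-c * (x * (√N)⁻¹) ^ 2) ^ N := by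
              gcongr
              exact norm_stepChar_le hp hD hsum h0 h1 ht
          _ = _ := by
              rw [← Real.exp_nat_mul]
              congr 1
              rw [mul_pow, inv_pow, Real.sq_sqrt (by positivity)]
              field_simp
      · simp only [G, Set.indicator_of_notMem hx, norm_zero]
        positivity
    · refine Eventually.of_forall fun x => ?_
      have hsqrt : Tendsto (fun N : ℕ => √(N : ℝ)) atTop atTop :=
        Real.tendsto_sqrt_atTop.comp tendsto_natCast_atTop_atTop
      have hinv : Tendsto (fun N : ℕ => Complex.exp (Complex.I * k * ((x * (√N)⁻¹ : ℝ) : ℂ)))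
          atTop (𝓝 1) := by
        have h : Tendsto (fun N : ℕ => x * (√(N : ℝ))⁻¹) atTop (𝓝 0) := by
          simpa using (tendsto_inv_atTop_zero.comp hsqrt).const_mul x
        have hcont : Continuous fun y : ℝ => Complex.exp (Complex.I * k * (y : ℂ)) := by fun_prop
        have := (hcont.tendsto 0).comp h
        rwa [Complex.ofReal_zero, mul_zero, Complex.exp_zero] at this
      have hlim := hinv.mul (tendsto_stepChar_pow hsum hmean x)
      rw [one_mul] at hlim
      refine hlim.congr' ?_
      filter_upwards [(hsqrt.const_mul_atTop hpi).eventually_gt_atTop |x|] with N hN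
      have hx : x ∈ Set.Ioc (-(Real.pi * √N)) (Real.pi * √N) :=
        ⟨(abs_lt.1 hN).1, (abs_lt.1 hN).2.le⟩
      simp only [G, Set.indicator_of_mem hx]
  have hGN : ∀ᶠ N : ℕ in atTop, ∫ x, G N x = ((2 * Real.pi * (√N *
      (X ^ k * (∑ i ∈ Finset.range (D + 1), C (p i) * X ^ i) ^ N : ℝ[X]).coeff N) : ℝ) : ℂ) := by
    filter_upwards [eventually_ge_atTop 1] with N hN
    have hs : 0 < √(N : ℝ) := Real.sqrt_pos.2 (by exact_mod_cast hN)
    rw [integral_indicator measurableSet_Ioc, ← intervalIntegral.integral_of_le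
      (by have := mul_pos hpi hs; linarith)]
    rw [intervalIntegral.integral_comp_mul_right
      (fun t : ℝ => Complex.exp (Complex.I * k * (t : ℂ)) * stepChar p D t ^ N)
      (inv_ne_zero hs.ne'), neg_mul, mul_assoc, mul_inv_cancel₀ hs.ne', mul_one, inv_inv,
      ← two_pi_mul_coeff_mul_pow, Complex.real_smul]
    push_cast
    ring
  have hlim := (hG.congr' hGN)
  rw [integral_complex_ofReal, integral_gaussian] at hlim
  have hre := (Complex.continuous_re.tendsto _).comp hlim
  simp only [Function.comp_def, Complex.ofReal_re] at hre
  have := hre.const_mul (2 * Real.pi)⁻¹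
  refine this.congr fun N => ?_
  rw [← mul_assoc, inv_mul_cancel₀ (by positivity), one_mul]

/-! ### Heights, finiteness, and trees with out-degrees at most one -/

namespace PlaneTree

theorem bounded_node_iff {D : ℕ} {cs : List PlaneTree} :
    (node cs).Bounded D ↔ cs.length ≤ D ∧ ∀ c ∈ cs, c.Bounded D := by
  have key : (∀ d ∈ (cs.map fun c => degrees c).sum, d ≤ D) ↔ ∀ c ∈ cs, c.Bounded D := by
    induction cs with
    | nil => simp
    | cons c cs ih =>
      simp only [List.map_cons, List.sum_cons, Multiset.mem_add, List.mem_cons, or_imp,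
        forall_and, ih, forall_eq]
      rfl
  rw [← key]
  simp [Bounded, degrees]

theorem Bounded.nbhd {D : ℕ} {T : PlaneTree} (h : T.Bounded D) (n : ℕ) :
    (PlaneTree.nbhd n T).Bounded D := by
  induction n generalizing T with
  | zero =>
    rw [PlaneTree.nbhd, bounded_node_iff]
    simp
  | succ n ih =>
    obtain ⟨cs⟩ := T
    rw [bounded_node_iff] at h
    rw [PlaneTree.nbhd, bounded_node_iff, List.length_map]
    refine ⟨h.1, fun c hc => ?_⟩
    obtain ⟨d, hd, rfl⟩ := List.mem_map.1 hc
    exact ih (h.2 d hd)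

theorem height_nbhd (n : ℕ) (T : PlaneTree) : (nbhd n T).height = min n T.height := by
  induction n generalizing T with
  | zero => simp [nbhd, height]
  | succ n ih =>
    obtain ⟨cs⟩ := T
    simp only [nbhd, height, List.map_map]
    induction cs with
    | nil => simp
    | cons c cs ihc =>
      simp only [List.map_cons, List.foldr_cons, ihc, Function.comp, ih]
      omega

theorem height_lt_of_mem {c : PlaneTree} {cs : List PlaneTree} (h : c ∈ cs) :
    c.height < (node cs).height := by
  rw [height]
  induction cs with
  | nil => simp at h
  | cons d cs ih =>
    simp only [List.map_cons, List.foldr_cons, lt_max_iff]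
    rcases List.mem_cons.1 h with rfl | h
    · exact Or.inl (Nat.lt_succ_self _)
    · exact Or.inr (ih h)

theorem finite_height_le (D n : ℕ) : {T : PlaneTree | T.height ≤ n ∧ T.Bounded D}.Finite := by
  induction n with
  | zero =>
    refine (Set.finite_singleton (node [])).subset ?_
    rintro ⟨cs⟩ ⟨h, -⟩
    cases cs with
    | nil => rfl
    | cons c cs =>
      have := height_lt_of_mem (List.mem_cons_self (a := c) (l := cs))
      omega
  | succ n ih =>
    have : Finite {T : PlaneTree | T.height ≤ n ∧ T.Bounded D} := ih
    refine ((List.finite_length_le {T : PlaneTree | T.height ≤ n ∧ T.Bounded D} D).image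
      (fun l => node (l.map Subtype.val))).subset ?_
    rintro ⟨cs⟩ ⟨hh, hb⟩
    rw [bounded_node_iff] at hb
    have h1 : ∀ c ∈ cs, c.height ≤ n ∧ c.Bounded D := fun c hc => by
      have := height_lt_of_mem hc
      exact ⟨by omega, hb.2 c hc⟩
    refine ⟨cs.attach.map (fun c => ⟨c.1, h1 c.1 c.2⟩), by simpa using hb.1, ?_⟩
    simp [List.map_map, Function.comp_def]

/-- Only finitely many trees have bounded out-degrees and height at most n, so their orders are
bounded. -/
theorem eventually_le_height (D n : ℕ) :
    ∀ᶠ N : ℕ in atTop, ∀ T : TreesOfOrder D N, n ≤ T.1.height := by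
  obtain ⟨M, hM⟩ := ((finite_height_le D n).image order).bddAbove
  filter_upwards [eventually_gt_atTop M] with N hN T
  by_contra h
  have := hM ⟨T.1, ⟨by omega, T.2.2⟩, rfl⟩
  have := T.2.1
  omega

theorem exists_order_eq_bounded {D : ℕ} (hD : 1 ≤ D) (N : ℕ) :
    ∃ T : PlaneTree, T.order = N + 1 ∧ T.Bounded D := by
  induction N with
  | zero => exact ⟨node [], by simp [order_node], by simp [bounded_node_iff]⟩
  | succ N ih =>
    obtain ⟨T, hT, hb⟩ := ih
    refine ⟨node [T], ?_, ?_⟩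
    · simp [order_node, hT]
      omega
    · simp [bounded_node_iff, hb, hD]

/-- Such trees are paths. This settles D = 1. -/
theorem eq_of_bounded_one {S T : PlaneTree} (hS : S.Bounded 1) (hT : T.Bounded 1)
    (h : S.height = T.height) : S = T := by
  generalize hn : S.height = n
  induction n generalizing S T with
  | zero =>
    obtain ⟨cs⟩ := S
    obtain ⟨ds⟩ := T
    rcases cs with _ | ⟨c, cs⟩
    · rcases ds with _ | ⟨d, ds⟩
      · rfl
      · have := height_lt_of_mem (List.mem_cons_self (a := d) (l := ds))
        omega
    · have := height_lt_of_mem (List.mem_cons_self (a := c) (l := cs))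
      omega
  | succ n ih =>
    obtain ⟨cs⟩ := S
    obtain ⟨ds⟩ := T
    rw [bounded_node_iff] at hS hT
    rcases cs with _ | ⟨c, _ | ⟨c', cs⟩⟩
    · simp [height] at hn
    · rcases ds with _ | ⟨d, _ | ⟨d', ds⟩⟩
      · simp [height] at h
      · simp only [height, List.map_cons, List.map_nil, List.foldr_cons, List.foldr_nil,
          Nat.max_zero] at h hn
        rw [ih (hS.2 c (by simp)) (hT.2 d (by simp)) (by omega) (by omega)]
      · simp at hT
    · simp at hS

end PlaneTree

/-! ### Total variation on a finite space -/

instance (D n : ℕ) : Finite (TreesOfHeight D n) :=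
  Set.Finite.to_subtype (s := {T : PlaneTree | T.height = n ∧ T.Bounded D})
    ((PlaneTree.finite_height_le D n).subset fun _ hT => ⟨le_of_eq hT.1, hT.2⟩)

instance : DiscreteMeasurableSpace PlaneTree := ⟨fun _ => MeasurableSpace.measurableSet_top⟩

/-- The variation is the least measure dominating the norm of the signed measure, and the weighted
sum of Dirac masses dominates it by the triangle inequality. -/
theorem tvDist_le_sum {α : Type*} [Fintype α] [MeasurableSpace α] [DiscreteMeasurableSpace α]
    (μ ν : Measure α) [IsFiniteMeasure μ] [IsFiniteMeasure ν] :
    tvDist μ ν ≤ ∑ a, ‖μ.real {a} - ν.real {a}‖ₑ := by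
  rw [tvDist, SignedMeasure.totalVariation_eq_variation]
  set s : SignedMeasure α := μ.toSignedMeasure - ν.toSignedMeasure with hs
  have hsing : ∀ a, s {a} = μ.real {a} - ν.real {a} := fun a => by
    rw [hs, Measure.toSignedMeasure_sub_apply (measurableSet_singleton a)]
  have hle : s.variation ≤ ∑ a, ‖μ.real {a} - ν.real {a}‖ₑ • Measure.dirac a := by
    classical
    refine VectorMeasure.variation_le_of_forall_enorm_le fun A _ => ?_
    have hA : s A = ∑ a, if a ∈ A then s {a} else 0 := by
      rw [hs, Measure.toSignedMeasure_sub_apply (MeasurableSet.of_discrete)]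
      have hm : ∀ (m : Measure α) [IsFiniteMeasure m],
          m.real A = ∑ a, if a ∈ A then m.real {a} else 0 := by
        intro m _
        rw [← Finset.sum_filter, sum_measureReal_singleton]
        simp
      rw [hm μ, hm ν, ← Finset.sum_sub_distrib]
      refine Finset.sum_congr rfl fun a _ => ?_
      rw [← hs, hsing]
      split_ifs <;> simp
    rw [hA, Measure.finsetSum_apply]
    refine (enorm_sum_le _ _).trans (Finset.sum_le_sum fun a _ => ?_)
    rw [Measure.smul_apply, Measure.dirac_apply]
    by_cases ha : a ∈ A <;> simp [ha, hsing]
  refine (hle Set.univ).trans ?_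
  simp [Measure.finsetSum_apply]

/-- On a finite space no mass escapes: the limits of the atoms sum to one. -/
theorem exists_tendsto_tvDist {α : Type*} [Finite α] [MeasurableSpace α]
    [DiscreteMeasurableSpace α] (μ : ℕ → Measure α) [∀ N, IsFiniteMeasure (μ N)]
    (hmass : ∀ᶠ N in atTop, μ N Set.univ = 1)
    (hlim : ∀ a, ∃ l : ENNReal, Tendsto (fun N => μ N {a}) atTop (𝓝 l)) :
    ∃ P : ProbabilityMeasure α,
      Tendsto (fun N => tvDist (μ N) (P : Measure α)) atTop (𝓝 0) := by
  have := Fintype.ofFinite α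
  choose l hl using hlim
  have hsum : ∑ a, l a = 1 := by
    refine tendsto_nhds_unique (tendsto_finsetSum Finset.univ fun a _ => hl a) ?_
    refine tendsto_const_nhds.congr' ?_
    filter_upwards [hmass] with N hN
    rw [sum_measure_singleton, Finset.coe_univ, hN]
  let P : Measure α := ∑ a, l a • Measure.dirac a
  have hP : IsProbabilityMeasure P := ⟨by simp [P, Measure.finsetSum_apply, hsum]⟩
  have hPa : ∀ a, P {a} = l a := by
    classical
    intro a
    simp only [P, Measure.finsetSum_apply, Measure.smul_apply, smul_eq_mul,
      Measure.dirac_apply' _ (measurableSet_singleton a)]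
    rw [Finset.sum_eq_single a] <;> simp +contextual
  refine ⟨⟨P, hP⟩, ?_⟩
  refine tendsto_of_tendsto_of_tendsto_of_le_of_le tendsto_const_nhds ?_ (fun _ => zero_le)
    (fun N => tvDist_le_sum (μ N) P)
  rw [← Finset.sum_const_zero (s := (Finset.univ : Finset α))]
  refine tendsto_finsetSum _ fun a _ => ?_
  have hla : l a ≠ ⊤ := by
    rw [← hPa]
    exact measure_ne_top _ _
  have h1 : Tendsto (fun N => (μ N).real {a} - P.real {a}) atTop (𝓝 0) := by
    rw [tendsto_sub_nhds_zero_iff, measureReal_def, hPa]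
    exact (ENNReal.tendsto_toReal hla).comp (hl a)
  have h2 := (continuous_enorm.tendsto (0 : ℝ)).comp h1
  rwa [enorm_zero] at h2

/-! ### Critical tilt and coefficient asymptotics -/

theorem exists_critical_tilt {y : ℕ → ℝ} {D : ℕ} (hy : ∀ i, 0 ≤ y i) (h0 : 0 < y 0)
    (h2 : 0 < y 2) (hD : 2 ≤ D) :
    ∃ s : ℝ, 0 < s ∧ ∑ i ∈ Finset.range (D + 1), y i * ((i : ℝ) - 1) * s ^ i = 0 := by
  obtain ⟨d, rfl⟩ : ∃ d, D = d + 2 := ⟨D - 2, by omega⟩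
  set g : ℝ → ℝ := fun s => ∑ i ∈ Finset.range (d + 2 + 1), y i * ((i : ℝ) - 1) * s ^ i with hg
  have hcont : Continuous g := by
    rw [hg]
    fun_prop
  have hg0 : g 0 = -y 0 := by
    rw [hg]
    simp [Finset.sum_range_succ']
  -- Chosen so that M ≥ 1 and y₂ M = y₂ + y₀; then y₂ M² outweighs y₀, the only negative term, and
  -- the intermediate value theorem applies.
  set M : ℝ := 1 + y 0 / y 2 with hM
  have hM1 : 1 ≤ M := by
    rw [hM]
    have : 0 ≤ y 0 / y 2 := by positivity
    linarith
  have hgM : 0 ≤ g M := by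
    have hsplit : g M = ∑ i ∈ Finset.range d,
        y (i + 1 + 1 + 1) * (((i + 1 + 1 + 1 : ℕ) : ℝ) - 1) * M ^ (i + 1 + 1 + 1) +
        (y 2 * M ^ 2 - y 0) := by
      rw [hg]
      simp only [Finset.sum_range_succ']
      norm_num
      ring
    have hrest : 0 ≤ ∑ i ∈ Finset.range d,
        y (i + 1 + 1 + 1) * (((i + 1 + 1 + 1 : ℕ) : ℝ) - 1) * M ^ (i + 1 + 1 + 1) := by
      refine Finset.sum_nonneg fun i _ => ?_
      have := hy (i + 1 + 1 + 1)
      have : (0 : ℝ) ≤ ((i + 1 + 1 + 1 : ℕ) : ℝ) - 1 := by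
        push_cast
        linarith [(Nat.cast_nonneg i : (0 : ℝ) ≤ i)]
      positivity
    have hyM : y 2 * M = y 2 + y 0 := by
      rw [hM]
      field_simp
    have : y 2 * M ≤ y 2 * M ^ 2 := by
      have : M ≤ M ^ 2 := by nlinarith
      gcongr
    linarith
  obtain ⟨s, ⟨hs0, -⟩, hs⟩ := intermediate_value_Icc (by linarith : (0 : ℝ) ≤ M)
    hcont.continuousOn ⟨by linarith [hg0], hgM⟩
  refine ⟨s, lt_of_le_of_ne hs0 ?_, hs⟩
  rintro rfl
  linarith [hg0.symm.trans hs]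

-- Replacing X by sX multiplies the N-th coefficient by s^N and the prefactor X^k by s^k.
open Polynomial in
theorem coeff_tilt (y : ℕ → ℝ) (D k N : ℕ) (s c : ℝ) :
    (X ^ k * (∑ i ∈ Finset.range (D + 1), C (c * (y i * s ^ i)) * X ^ i) ^ N : ℝ[X]).coeff N * s ^ k
      = c ^ N * s ^ N * (X ^ k * (∑ i ∈ Finset.range (D + 1), C (y i) * X ^ i) ^ N : ℝ[X]).coeff N
      := by
  set φ : ℝ[X] := ∑ i ∈ Finset.range (D + 1), C (y i) * X ^ i with hφ
  have h1 : (∑ i ∈ Finset.range (D + 1), C (c * (y i * s ^ i)) * X ^ i : ℝ[X]) =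
      C c * φ.comp (C s * X) := by
    rw [hφ, sum_comp, Finset.mul_sum]
    refine Finset.sum_congr rfl fun i _ => ?_
    simp [mul_pow]
    ring
  have h2 : C (s ^ k) * (X ^ k * (C c * φ.comp (C s * X)) ^ N) =
      C (c ^ N) * (X ^ k * φ ^ N).comp (C s * X) := by
    simp [mul_pow]
    ring
  have h3 := congrArg (fun p => p.coeff N) h2
  simp only [coeff_C_mul, comp_C_mul_X_coeff] at h3
  rw [h1]
  linear_combination h3

-- The factor N comes from Lagrange inversion and √N from the local limit theorem; τ = s/φ(s) undoes
-- the tilt, and A k = k s^k L.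
open Polynomial in
theorem tendsto_lagrangeCoeff {y : ℕ → ℝ} {D : ℕ} (hy : ∀ i, 0 ≤ y i) (h0 : 0 < y 0)
    (h1 : 0 < y 1) (h2 : 0 < y 2) (hD : 2 ≤ D) :
    ∃ (τ : ℝ) (A : ℕ → ℝ), 0 < τ ∧ 0 < A 1 ∧ ∀ k, Tendsto (fun N : ℕ =>
      lagrangeCoeff (∑ i ∈ Finset.range (D + 1), C (y i) * X ^ i) k N * τ ^ N * (N * √N))
      atTop (𝓝 (A k)) := by
  obtain ⟨s, hs, hcrit⟩ := exists_critical_tilt hy h0 h2 hD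
  set Φ : ℝ := ∑ i ∈ Finset.range (D + 1), y i * s ^ i with hΦ
  have hΦpos : 0 < Φ := by
    have : y 0 * s ^ 0 ≤ Φ := Finset.single_le_sum (f := fun i : ℕ => y i * s ^ i)
      (fun i _ => mul_nonneg (hy i) (by positivity)) (by simp)
    rw [pow_zero, mul_one] at this
    linarith
  obtain ⟨L, hL, hlim⟩ := tendsto_sqrt_mul_coeff (p := fun i => Φ⁻¹ * (y i * s ^ i)) (D := D)
    (fun i => by have := hy i; positivity) (by omega)
    (by rw [← Finset.mul_sum, inv_mul_cancel₀ hΦpos.ne'])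
    (by
      rw [← mul_zero Φ⁻¹, ← hcrit, Finset.mul_sum]
      exact Finset.sum_congr rfl fun i _ => by ring)
    (by positivity) (by positivity)
  refine ⟨Φ⁻¹ * s, fun k => k * s ^ k * L, by positivity, ?_, fun k => ?_⟩
  · simp only [Nat.cast_one]
    positivity
  · refine ((hlim k).const_mul (k * s ^ k)).congr' ?_
    filter_upwards [eventually_ge_atTop 1] with N hN
    have hN0 : (N : ℝ) ≠ 0 := by
      have : (0 : ℝ) < N := by exact_mod_cast hN
      exact this.ne'
    rw [lagrangeCoeff, if_neg (by omega), mul_pow]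
    have := coeff_tilt y D k N s Φ⁻¹
    field_simp
    field_simp at this
    linear_combination k * this

/-- The ratios of the coefficients of the powers of the critical generating function converge. -/
theorem exists_tendsto_lagrangeCoeff_div {y : ℕ → ℝ} {D : ℕ} (hy : ∀ i, 0 ≤ y i) (h0 : 0 < y 0)
    (h1 : 0 < y 1) (h2 : 0 < y 2) (hD : 2 ≤ D) (k m : ℕ) :
    ∃ l : ℝ, Tendsto (fun N : ℕ =>
      lagrangeCoeff (∑ i ∈ Finset.range (D + 1), Polynomial.C (y i) * Polynomial.X ^ i) k N /
      lagrangeCoeff (∑ i ∈ Finset.range (D + 1), Polynomial.C (y i) * Polynomial.X ^ i) 1 (N + m))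
      atTop (𝓝 l) := by
  obtain ⟨τ, A, hτ, hA1, hlim⟩ := tendsto_lagrangeCoeff hy h0 h1 h2 hD
  set f := lagrangeCoeff (∑ i ∈ Finset.range (D + 1), Polynomial.C (y i) * Polynomial.X ^ i)
  have hq : Tendsto (fun N : ℕ => 1 + (m : ℝ) / N) atTop (𝓝 1) := by
    simpa using (tendsto_const_div_atTop_nhds_zero_nat (m : ℝ)).const_add 1
  have hr : Tendsto (fun N : ℕ => (1 + (m : ℝ) / N) * √(1 + (m : ℝ) / N)) atTop (𝓝 1) := by
    simpa using hq.mul ((Real.continuous_sqrt.tendsto _).comp hq)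
  -- τ^m comes from the shift of the index, and the final 1 is the limit of ((N+m)/N)^(3/2).
  refine ⟨A k / A 1 * τ ^ m * 1, ?_⟩
  have hden := (hlim 1).comp (tendsto_add_atTop_nat m)
  refine ((((hlim k).div hden hA1.ne').mul_const (τ ^ m)).mul hr).congr' ?_
  filter_upwards [eventually_ge_atTop 1] with N hN
  have hN0 : (0 : ℝ) < N := by exact_mod_cast hN
  have hs : √((N : ℝ) + m) = √N * √(1 + (m : ℝ) / N) := by
    rw [← Real.sqrt_mul hN0.le]
    congr 1
    field_simp
  have hu : (0 : ℝ) < √(1 + (m : ℝ) / N) := by positivity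
  have hsN : (0 : ℝ) < √(N : ℝ) := by positivity
  have hm : (N : ℝ) + m = N * (1 + (m : ℝ) / N) := by field_simp
  have hq0 : (0 : ℝ) < 1 + (m : ℝ) / N := by positivity
  simp only [Function.comp, Nat.cast_add, Pi.div_apply]
  rw [hs, hm, pow_add]
  by_cases hf : f 1 (N + m) = 0
  · simp [hf]
  · set q := 1 + (m : ℝ) / N
    field_simp

/-! ### Gibbs masses as ratios of coefficients -/

/-- The Boltzmann weight of a vertex of out-degree `i`. -/
noncomputable def vertexWeight {D : ℕ} (E : Fin (D + 1) → ℝ) (β : ℝ) (i : ℕ) : ℝ :=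
  if h : i < D + 1 then Real.exp (-β * E ⟨i, h⟩) else 0

section

variable {D : ℕ} (E : Fin (D + 1) → ℝ) (β : ℝ)

theorem vertexWeight_pos {i : ℕ} (hi : i ≤ D) : 0 < vertexWeight E β i := by
  rw [vertexWeight, dif_pos (by omega)]
  positivity

theorem vertexWeight_nonneg (i : ℕ) : 0 ≤ vertexWeight E β i := by
  unfold vertexWeight
  split_ifs <;> positivity

open scoped Classical in
theorem prod_map_vertexWeight (s : Multiset ℕ) :
    (s.map fun i => ENNReal.ofReal (vertexWeight E β i)).prod =
      if ∀ d ∈ s, d ≤ D then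
        ENNReal.ofReal (Real.exp (-β * ∑ i : Fin (D + 1), (s.count (i : ℕ) : ℝ) * E i))
      else 0 := by
  induction s using Multiset.induction_on with
  | empty => simp
  | cons a s ih =>
    rw [Multiset.map_cons, Multiset.prod_cons, ih]
    by_cases ha : a ≤ D
    · by_cases hs : ∀ d ∈ s, d ≤ D
      · rw [if_pos hs, if_pos (by simpa [ha] using hs),
          ← ENNReal.ofReal_mul (vertexWeight_nonneg E β a), vertexWeight, dif_pos (by omega),
          ← Real.exp_add]
        congr 2
        simp only [Multiset.count_cons, Nat.cast_add, add_mul, Finset.sum_add_distrib]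
        have : ∑ i : Fin (D + 1), (((if (i : ℕ) = a then 1 else 0 : ℕ) : ℝ) * E i) =
            E ⟨a, by omega⟩ := by
          rw [Finset.sum_eq_single ⟨a, by omega⟩]
          · simp
          · intro b _ hb
            have : (b : ℕ) ≠ a := fun h => hb (Fin.ext h)
            simp [this]
          · simp
        rw [this]
        ring
      · rw [if_neg hs, if_neg (fun h => hs fun d hd => h d (Multiset.mem_cons_of_mem hd)), mul_zero]
    · rw [vertexWeight, dif_neg (by omega), ENNReal.ofReal_zero, zero_mul, if_neg]
      exact fun h => ha (h a (Multiset.mem_cons_self a s))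

open scoped Classical in
theorem weight_vertexWeight (T : PlaneTree) :
    T.weight (fun i => ENNReal.ofReal (vertexWeight E β i)) =
      if T.Bounded D then ENNReal.ofReal (Real.exp (-β * energy E T)) else 0 := by
  rw [PlaneTree.weight, prod_map_vertexWeight]
  congr 1

-- Out-degrees above D have weight zero, so a sum over bounded trees becomes a coefficient of a
-- series over all plane trees.
open scoped Classical in
theorem sum_treesOfOrder (N : ℕ) (A : PlaneTree → Prop) :
    ∑ T : TreesOfOrder D N, (if A T.1 then ENNReal.ofReal (Real.exp (-β * energy E T.1)) else 0) =
      PowerSeries.coeff N (genFun PlaneTree.order fun T =>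
        if A T then T.weight (fun i => ENNReal.ofReal (vertexWeight E β i)) else 0) := by
  rw [genFun, PowerSeries.coeff_mk, ← tsum_fintype (L := SummationFilter.unconditional _)]
  have h := tsum_subtype {T : PlaneTree | T.order = N ∧ T.Bounded D}
    (fun T => if A T then ENNReal.ofReal (Real.exp (-β * energy E T)) else 0)
  refine h.trans (tsum_congr fun T => ?_)
  rw [weight_vertexWeight, Set.indicator_apply]
  by_cases hN : T.order = N <;> by_cases hb : T.Bounded D <;> simp [hN, hb]

theorem ofReal_partitionFunction (N : ℕ) :
    ENNReal.ofReal (partitionFunction E β N) =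
      PowerSeries.coeff N (PlaneTree.gf fun i => ENNReal.ofReal (vertexWeight E β i)) := by
  classical
  have h := sum_treesOfOrder E β N (fun _ => True)
  simp only [if_true] at h
  rw [PlaneTree.gf, ← h, partitionFunction,
    ENNReal.ofReal_sum_of_nonneg fun _ _ => (Real.exp_pos _).le]

theorem ofReal_exp_div_partitionFunction {N : ℕ} (T : TreesOfOrder D N) :
    ENNReal.ofReal (Real.exp (-β * energy E T.1) / partitionFunction E β N) =
      ENNReal.ofReal (Real.exp (-β * energy E T.1)) /
        ENNReal.ofReal (partitionFunction E β N) := by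
  refine ENNReal.ofReal_div_of_pos ?_
  have : Nonempty (TreesOfOrder D N) := ⟨T⟩
  exact Finset.sum_pos (fun _ _ => Real.exp_pos _) Finset.univ_nonempty

theorem measurableEmbedding_treesOfHeight (n : ℕ) :
    MeasurableEmbedding (Subtype.val : TreesOfHeight D n → PlaneTree) :=
  ⟨Subtype.val_injective, measurable_subtype_coe, fun {_} _ => MeasurableSpace.measurableSet_top⟩

theorem rootLaw_apply (n N : ℕ) (A : Set (TreesOfHeight D n)) :
    rootLaw E β n N A = gibbs E β N {T | PlaneTree.nbhd n T.1 ∈ Subtype.val '' A} := by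
  rw [rootLaw, (measurableEmbedding_treesOfHeight n).comap_apply, Measure.map_apply]
  · rfl
  · exact Measurable.of_discrete
  · exact MeasurableSet.of_discrete

theorem rootLaw_singleton (n N : ℕ) (S : TreesOfHeight D n) :
    rootLaw E β n N {S} =
      PowerSeries.coeff N
        (PlaneTree.fiberGF (fun i => ENNReal.ofReal (vertexWeight E β i)) n S.1) /
      PowerSeries.coeff N (PlaneTree.gf fun i => ENNReal.ofReal (vertexWeight E β i)) := by
  classical
  rw [rootLaw_apply, gibbs, Measure.finsetSum_apply, PlaneTree.fiberGF,
    ← sum_treesOfOrder E β N (fun T => PlaneTree.nbhd n T = S.1), ← ofReal_partitionFunction,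
    div_eq_mul_inv, Finset.sum_mul]
  refine Finset.sum_congr rfl fun T _ => ?_
  rw [Measure.smul_apply, Measure.dirac_apply' _ MeasurableSet.of_discrete,
    ofReal_exp_div_partitionFunction, Set.indicator_apply]
  by_cases h : PlaneTree.nbhd n T.1 = S.1 <;> simp [h, div_eq_mul_inv]

theorem gibbs_univ (hD : 1 ≤ D) {N : ℕ} (hN : 1 ≤ N) : gibbs E β N Set.univ = 1 := by
  obtain ⟨T, hT, hb⟩ := PlaneTree.exists_order_eq_bounded hD (N - 1)
  have hne : Nonempty (TreesOfOrder D N) := ⟨⟨T, by omega, hb⟩⟩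
  have hpos : 0 < partitionFunction E β N :=
    Finset.sum_pos (fun _ _ => Real.exp_pos _) Finset.univ_nonempty
  simp only [gibbs, Measure.finsetSum_apply, Measure.smul_apply, measure_univ, smul_eq_mul, mul_one]
  rw [← ENNReal.ofReal_sum_of_nonneg fun _ _ => div_nonneg (Real.exp_pos _).le hpos.le,
    ← Finset.sum_div]
  change ENNReal.ofReal (partitionFunction E β N / _) = 1
  rw [div_self hpos.ne', ENNReal.ofReal_one]

theorem eventually_nbhd_mem (D n : ℕ) :
    ∀ᶠ N : ℕ in atTop, ∀ T : TreesOfOrder D N,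
      (PlaneTree.nbhd n T.1).height = n ∧ (PlaneTree.nbhd n T.1).Bounded D := by
  filter_upwards [PlaneTree.eventually_le_height D n] with N hN T
  exact ⟨by rw [PlaneTree.height_nbhd, min_eq_left (hN T)], T.2.2.nbhd n⟩

theorem eventually_rootLaw_univ (hD : 1 ≤ D) (n : ℕ) :
    ∀ᶠ N : ℕ in atTop, rootLaw E β n N Set.univ = 1 := by
  filter_upwards [eventually_nbhd_mem D n, eventually_ge_atTop 1] with N hN hN1
  rw [rootLaw_apply, ← gibbs_univ E β hD hN1]
  congr 1
  ext T
  simpa using hN T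

theorem exists_tendsto_rootLaw_singleton (hD : 2 ≤ D) (n : ℕ) (S : TreesOfHeight D n) :
    ∃ l : ENNReal, Tendsto (fun N => rootLaw E β n N {S}) atTop (𝓝 l) := by
  set x : ℕ → ENNReal := fun i => ENNReal.ofReal (vertexWeight E β i) with hx
  have hy := vertexWeight_nonneg E β
  obtain ⟨r, m, k, hr, hS⟩ := PlaneTree.fiberGF_eq_monomial x
    (fun _ => ENNReal.ofReal_ne_top) n S.1
  have hgf := coeff_pow_eq_lagrangeCoeff (vertexWeight E β) hy D (PlaneTree.gf x)
    (PlaneTree.gf_eq x D fun i hi => by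
      rw [hx]
      simp only
      rw [vertexWeight, dif_neg (by omega), ENNReal.ofReal_zero])
  obtain ⟨l, hl⟩ := exists_tendsto_lagrangeCoeff_div hy (vertexWeight_pos E β (by omega))
    (vertexWeight_pos E β (by omega)) (vertexWeight_pos E β hD) hD k m
  refine ⟨r * ENNReal.ofReal l, ?_⟩
  -- At index N + m the factor X^m cancels, leaving the N-th coefficient of the power of F.
  rw [← tendsto_add_atTop_iff_nat m]
  refine (ENNReal.Tendsto.const_mul (ENNReal.tendsto_ofReal hl) (Or.inr hr)).congr' ?_
  filter_upwards [eventually_ge_atTop 1] with N hN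
  obtain ⟨T, hT, hb⟩ := PlaneTree.exists_order_eq_bounded (by omega : 1 ≤ D) (N + m - 1)
  have hne : Nonempty (TreesOfOrder D (N + m)) := ⟨⟨T, by omega, hb⟩⟩
  have hZ : 0 < partitionFunction E β (N + m) :=
    Finset.sum_pos (fun _ _ => Real.exp_pos _) Finset.univ_nonempty
  have h1 := hgf 1 (N + m)
  rw [pow_one, ← ofReal_partitionFunction] at h1
  have hpos := ENNReal.ofReal_pos.1 (h1 ▸ ENNReal.ofReal_pos.2 hZ)
  rw [rootLaw_singleton, hS, mul_assoc, PowerSeries.coeff_C_mul, PowerSeries.coeff_X_pow_mul,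
    hgf, ← ofReal_partitionFunction, h1, ENNReal.ofReal_div_of_pos hpos, mul_div_assoc]

end

theorem theorem1 (D : ℕ) (hD : 1 ≤ D) (E : Fin (D + 1) → ℝ) (β : ℝ) (n : ℕ) :
    (∀ᶠ N : ℕ in atTop, ∀ T : TreesOfOrder D N,
      (PlaneTree.nbhd n T.1).height = n ∧ (PlaneTree.nbhd n T.1).Bounded D) ∧
    ∃ P : ProbabilityMeasure (TreesOfHeight D n),
      Tendsto (fun N : ℕ => tvDist (rootLaw E β n N) (P : Measure (TreesOfHeight D n)))
        atTop (𝓝 0) := by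
  refine ⟨eventually_nbhd_mem D n, ?_⟩
  have hmass := eventually_rootLaw_univ E β hD n
  refine exists_tendsto_tvDist _ hmass fun S => ?_
  rcases Nat.lt_or_ge 1 D with hD2 | hD1
  · exact exists_tendsto_rootLaw_singleton E β hD2 n S
  -- The tilt equation would read -y₀ = 0 here, so the one-point space S_n is treated directly.
  · obtain rfl : D = 1 := le_antisymm hD1 hD
    have huniv : ({S} : Set (TreesOfHeight 1 n)) = Set.univ :=
      Set.eq_univ_of_forall fun T =>
        Subtype.ext (PlaneTree.eq_of_bounded_one T.2.2 S.2.2 (T.2.1.trans S.2.1.symm))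
    refine ⟨1, tendsto_const_nhds.congr' ?_⟩
    filter_upwards [hmass] with N hN
    rw [huniv, hN]
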